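/- Let $G=(\mathcal V,\mathcal A)$ be a finite directed (multi)graph, $\mathcal A_1\subseteq\mathcal A$ the set of tolled arcs, $n=|\mathcal A_1|$, and let $c\in\mathbb R^{\mathcal A}$ be costs with $c_a\ge 0$ for every toll-free arc $a\in\mathcal A\setminus\mathcal A_1$. Let $\mathcal K$ be a finite set of commodities $k$, each with an origin $o^k$ and a destination $d^k$ joined by a path of toll-free arcs (the single-commodity problem is the case $|\mathcal K|=1$). Let $A$ be the vertex-arc incidence matrix of $G$ (entry $+1$ at the tail and $-1$ at the head of an arc) and $b^k=e_{o^k}-e_{d^k}$. For $t\in\mathbb R^{\mathcal A_1}$ consider the linear program in $w\in\mathbb R^{\mathcal A_1}$ and $x^k\in\mathbb R^{\mathcal A}$ $$\min_{w,\,x}\ \Big\{\textstyle\sum_{k} c^\top x^k+t^\top w \;:\; \sum_k x^k_{\mathcal A_1}\le w,\ A x^k=b^k\ (k\in\mathcal K),\ w\ge 0,\ x^k\ge 0\ (k\in\mathcal K)\Big\}.\qquad(\mathrm P_t)$$ Let $f(t)\in[-\infty,\infty)$ be its optimal value if $t\ge 0$, and $f(t)=-\infty$ if $t\not\ge 0$;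 let $g(w)=\sup_{t}\{f(t)-t^\top w\}$. Let $\mathbf W(t)$ be the set of all $w$ for which some $(w,x)$ is an optimal solution of $(\mathrm P_t)$, and put $\mathbf W(T)=\bigcap_{t\in T}\mathbf W(t)$ for $T\subseteq\mathbb R^{\mathcal A_1}$. The epigraph of $\varphi$ is $\operatorname{epi}(\varphi)=\{(y,z)\in\mathbb R^{\mathcal A_1}\times\mathbb R : z\ge\varphi(y)\}$. A nonempty face $F$ of an epigraph is non-vertical if $(0,1)$ is not a direction of its affine hull. An action set is the projection to $\mathbb R^{\mathcal A_1}$ of a non-vertical face of $\operatorname{epi}(-f)$, and a reaction set is the projection to $\mathbb R^{\mathcal A_1}$ of a non-vertical face of $\operatorname{epi}(g)$. The dimension of a set is that of its affine hull. Then: 1. For every action set $T$, the set $\mathbf W(T)$ is a reaction set, and $\dim T+\dim\mathbf W(T)=n$. 2. The map $T\mapsto\mathbf W(T)$ is a bijection from the action sets onto the reaction sets. 3. For a non-vertical face $F$ of $\operatorname{epi}(-f)$ with projection $T$, let $\Phi(F)=\{(w,g(w)) : w\in\mathbf W(T)\}$. Then $\Phi$ is a bijection from the non-vertical faces of $\operatorname{epi}(-f)$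 onto the non-vertical faces of $\operatorname{epi}(g)$, and $\dim F+\dim\Phi(F)=n$ for every such $F$. -/

import Mathlib

open scoped Matrix

/-- A network pricing instance with commodities `K`: a finite directed multigraph with vertices `V`
and arcs `A`, a set `tolled` of tolled arcs, base costs `c` (nonnegative on toll-free arcs),
and origins and destinations joined by toll-free paths. -/
structure NPP (V A K : Type*) where
  tail : A → V
  head : A → V
  tolled : Finset A
  c : A → ℝ
  orig : K → V
  dest : K → V
  cost_nonneg : ∀ a, a ∉ tolled → 0 ≤ c a
  exists_tollFree_path : ∀ k, Relation.ReflTransGen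
    (fun u v => ∃ a, a ∉ tolled ∧ tail a = u ∧ head a = v) (orig k) (dest k)

/-- The epigraph of an extended-real-valued function. -/
def epi {E : Type*} (φ : E → EReal) : Set (E × ℝ) := {p | φ p.1 ≤ (p.2 : EReal)}

/-- The dimension of (the affine hull of) a nonempty set. -/
noncomputable def affDim {E : Type*} [AddCommGroup E] [Module ℝ E] (S : Set E) : ℕ :=
  Module.finrank ℝ (affineSpan ℝ S).direction

/-- `F` is a nonempty face of the polyhedron `P` such that `(0, 1)` is not a direction
of the affine hull of `F`. Faces of a polyhedron are the sets of maximizers of a linear functional;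
the zero functional gives `P` itself. -/
def IsNonverticalFace {E : Type*} [AddCommGroup E] [Module ℝ E] [TopologicalSpace E]
    (P F : Set (E × ℝ)) : Prop :=
  IsExposed ℝ P F ∧ F.Nonempty ∧ ((0, 1) : E × ℝ) ∉ (affineSpan ℝ F).direction

namespace NPP

/-- Vectors indexed by the tolled arcs (tolls `t` and reduced reactions `w`). -/
abbrev Vec {V A K : Type*} (N : NPP V A K) : Type _ := {a : A // a ∈ N.tolled} → ℝ

/-- The incidence matrix of the graph. -/
def incMatrix {V A K : Type*} [DecidableEq V] (N : NPP V A K) : Matrix V A ℝ :=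
  fun v a => (if N.tail a = v then 1 else 0) - (if N.head a = v then 1 else 0)

/-- The source-sink vector of commodity `k`. -/
def b {V A K : Type*} [DecidableEq V] (N : NPP V A K) (k : K) : V → ℝ :=
  fun v => (if N.orig k = v then 1 else 0) - (if N.dest k = v then 1 else 0)

/-- Feasibility of `(w, x)` in the aggregated follower problem. -/
def Feasible {V A K : Type*} [DecidableEq V] [Fintype A] [Fintype K] (N : NPP V A K)
    (w : N.Vec) (x : K → A → ℝ) : Prop :=
  (∀ a : {a : A // a ∈ N.tolled}, ∑ k, x k a ≤ w a) ∧
    (∀ k, N.incMatrix *ᵥ x k = N.b k) ∧ 0 ≤ w ∧ ∀ k, 0 ≤ x k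

/-- The objective of the aggregated follower problem at tolls `t`. -/
def cost {V A K : Type*} [Fintype A] [Fintype K] (N : NPP V A K)
    (t w : N.Vec) (x : K → A → ℝ) : ℝ :=
  ∑ k, N.c ⬝ᵥ x k + t ⬝ᵥ w

open Classical in
/-- The follower's optimal cost as a function of the tolls, `-∞` unless `t ≥ 0`. -/
noncomputable def f {V A K : Type*} [DecidableEq V] [Fintype A] [Fintype K] (N : NPP V A K)
    (t : N.Vec) : EReal :=
  if 0 ≤ t then ⨅ (w : N.Vec) (x : K → A → ℝ) (_ : N.Feasible w x), (N.cost t w x : EReal) else ⊥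

/-- The convex conjugate of `t ↦ -f (-t)`: `g w = sup_t (f t - tᵀ w)`. -/
noncomputable def g {V A K : Type*} [DecidableEq V] [Fintype A] [Fintype K] (N : NPP V A K)
    (w : N.Vec) : EReal :=
  ⨆ t : N.Vec, N.f t - ((t ⬝ᵥ w : ℝ) : EReal)

/-- Projections of non-vertical faces of `epi (-f)`. -/
def IsActionSet {V A K : Type*} [DecidableEq V] [Fintype A] [Fintype K] (N : NPP V A K)
    (T : Set N.Vec) : Prop :=
  ∃ F : Set (N.Vec × ℝ), IsNonverticalFace (epi (-N.f)) F ∧ T = Prod.fst '' F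

/-- Projections of non-vertical faces of `epi g`. -/
def IsReactionSet {V A K : Type*} [DecidableEq V] [Fintype A] [Fintype K] (N : NPP V A K)
    (W : Set N.Vec) : Prop :=
  ∃ G : Set (N.Vec × ℝ), IsNonverticalFace (epi N.g) G ∧ W = Prod.fst '' G

/-- The set `W(t)` of all `w` that are optimal in the aggregated follower problem at tolls `t`. -/
def optW {V A K : Type*} [DecidableEq V] [Fintype A] [Fintype K] (N : NPP V A K)
    (t : N.Vec) : Set N.Vec :=
  {w | ∃ x, N.Feasible w x ∧ ∀ w' x', N.Feasible w' x' → N.cost t w x ≤ N.cost t w' x'}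

/-- `W(T) = ⋂ t ∈ T, W(t)`. -/
def setW {V A K : Type*} [DecidableEq V] [Fintype A] [Fintype K] (N : NPP V A K)
    (T : Set N.Vec) : Set N.Vec :=
  ⋂ t ∈ T, N.optW t

/-- The part of the graph of `g` above `W`. -/
def liftG {V A K : Type*} [DecidableEq V] [Fintype A] [Fintype K] (N : NPP V A K)
    (W : Set N.Vec) : Set (N.Vec × ℝ) :=
  {p | p.1 ∈ W ∧ N.g p.1 = (p.2 : EReal)}

end NPP

/-! # Duality of action and reaction sets in network pricing -/

/-! The key is a symmetric description of optimality: `w ∈ N.optW t` holds exactly when `f t` is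
finite and `f t = g w + t ⬝ᵥ w` (`mem_optW_iff`). Weak duality gives one direction, linear
programming duality the other. Consequently the non-vertical faces of `epi (-f)` are the graphs of
`-f` over the nonempty sets `{t | w ∈ N.optW t}`, and those of `epi g` are the graphs of `g` over
the nonempty sets `N.optW t`.

The duality gap `g w + t ⬝ᵥ w - f t` is nonnegative, and affine along an action or reaction set. If
it vanishes at a relatively interior point, it vanishes on the whole set. So `setW T = optW t₀` for
`t₀` relatively interior to `T`, and every reaction set arises from one of its own relatively
interior points. Since `T` is recovered as `{t | setW T ⊆ optW t}`, the map is injective.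

For the dimensions, vanishing gaps make the directions of `T` and `optW t₀` orthogonal.
Polyhedrality makes them full orthogonal complements: a small move of `t₀` orthogonal to `optW t₀`
keeps a reaction optimal (`exists_mem_optW_add_smul`). -/

namespace PointedCone

/-! ### Finitely generated cones -/

variable {E F : Type*} [AddCommGroup E] [Module ℝ E] [FiniteDimensional ℝ E]
  [AddCommGroup F] [Module ℝ F]

/-- **Fourier–Motzkin elimination**: a finitely generated cone is an intersection of finitely many
half-spaces. -/
theorem exists_finite_dual_hull (S : Finset E) :
    ∃ L : Set (Module.Dual ℝ E), L.Finite ∧ ∀ x, x ∈ hull ℝ (S : Set E) ↔ ∀ l ∈ L, 0 ≤ l x := by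
  classical
  induction S using Finset.induction_on with
  | empty =>
    let B := Module.finBasis ℝ E
    refine ⟨Set.range B.coord ∪ Set.range (fun i => -B.coord i), Set.toFinite _, fun x => ?_⟩
    simp only [Finset.coe_empty, Submodule.span_empty, Submodule.mem_bot, Set.mem_union, or_imp,
      forall_and, Set.forall_mem_range]
    constructor
    · rintro rfl
      simp
    · rintro ⟨h1, h2⟩
      refine B.forall_coord_eq_zero_iff.mp fun i => le_antisymm ?_ (h1 i)
      simpa using h2 i
  | insert v S _ ih =>
    obtain ⟨L, hL, h⟩ := ih
    -- Membership of `x` means that `x - a • v` satisfies `L` for some `a ≥ 0`. Forms negative at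
    -- `v` bound `a` below, forms positive at `v` bound it above; each mixed form pairs two bounds
    -- and vanishes at `v`.
    refine ⟨{l ∈ L | 0 ≤ l v} ∪
      Set.image2 (fun l m => l v • m - m v • l) {l ∈ L | 0 ≤ l v} {l ∈ L | l v < 0},
      (hL.sep _).union ((hL.sep _).image2 _ (hL.sep _)), fun x => ?_⟩
    rw [Finset.coe_insert, Submodule.mem_span_insert]
    constructor
    · rintro ⟨⟨a, ha⟩, z, hz, rfl⟩
      have hz' := (h z).mp hz
      rintro l (⟨hl, hlv⟩ | ⟨l, ⟨hl, hlv⟩, m, ⟨hm, hmv⟩, rfl⟩)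
      · have : 0 ≤ a * l v + l z := add_nonneg (mul_nonneg ha hlv) (hz' l hl)
        simpa [Nonneg.mk_smul] using this
      · have h1 := mul_nonneg hlv (hz' m hm)
        have h2 := mul_nonneg (neg_nonneg.2 hmv.le) (hz' l hl)
        simp only [Nonneg.mk_smul, LinearMap.sub_apply, LinearMap.smul_apply, map_add, map_smul,
          smul_eq_mul]
        linarith
    · intro hx
      -- The coefficient of `v` is the largest of the finitely many lower bounds, including `0`.
      obtain ⟨a, ha, hmax⟩ := Set.exists_max_image
        (insert 0 ((fun l : Module.Dual ℝ E => l x / l v) '' {l ∈ L | l v < 0})) id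
        (((hL.sep _).image _).insert _) (Set.insert_nonempty _ _)
      have ha0 : 0 ≤ a := hmax 0 (Set.mem_insert _ _)
      refine ⟨⟨a, ha0⟩, x - a • v, (h _).mpr fun l hl => ?_, by simp [Nonneg.mk_smul]⟩
      rw [map_sub, map_smul, smul_eq_mul]
      rcases lt_or_ge (l v) 0 with hlv | hlv
      · have := hmax _ (Set.mem_insert_of_mem _ ⟨l, ⟨hl, hlv⟩, rfl⟩)
        simp only [id] at this
        rw [div_le_iff_of_neg hlv] at this
        linarith
      · rcases ha with rfl | ⟨m, ⟨hm, hmv⟩, rfl⟩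
        · simpa using hx l (Or.inl ⟨hl, hlv⟩)
        · have := hx _ (Or.inr ⟨l, ⟨hl, hlv⟩, m, ⟨hm, hmv⟩, rfl⟩)
          simp only [LinearMap.sub_apply, LinearMap.smul_apply, smul_eq_mul] at this
          have e : l x - m x / m v * l v = (l v * m x - m v * l x) / (-m v) := by
            have := hmv.ne
            field_simp
            ring
          rw [e]
          exact div_nonneg this (by linarith)

/-- **Farkas' lemma** for finitely generated cones. -/
theorem exists_dual_neg_of_fg {C : PointedCone ℝ E} (hC : C.FG) {x : E} (hx : x ∉ C) :
    ∃ l : Module.Dual ℝ E, (∀ y ∈ C, 0 ≤ l y) ∧ l x < 0 := by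
  obtain ⟨S, rfl⟩ := hC
  obtain ⟨L, -, h⟩ := exists_finite_dual_hull S
  rw [h] at hx
  push Not at hx
  obtain ⟨l, hl, hlx⟩ := hx
  exact ⟨l, fun y hy => (h y).mp hy l hl, hlx⟩

/-- **Minkowski–Weyl theorem**: a finite intersection of half-spaces is a finitely generated
cone. -/
theorem exists_hull_of_finite_dual {L : Set (Module.Dual ℝ E)} (hL : L.Finite) :
    ∃ S : Finset E, ∀ x, x ∈ hull ℝ (S : Set E) ↔ ∀ l ∈ L, 0 ≤ l x := by
  classical
  -- The inequalities describing the cone spanned by `L` in the dual space become, by double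
  -- duality, the generators sought in `E`.
  obtain ⟨M, hM, h⟩ := exists_finite_dual_hull hL.toFinset
  rw [hL.coe_toFinset] at h
  let e := Module.evalEquiv ℝ E
  have he : ∀ (m : Module.Dual ℝ (Module.Dual ℝ E)) l, m l = l (e.symm m) := fun m l => by
    simp [e]
  refine ⟨(hM.image e.symm).toFinset, fun x => ?_⟩
  constructor
  · intro hx l hl
    refine Submodule.span_induction (p := fun y _ => 0 ≤ l y) ?_ (by simp) ?_ ?_ hx
    · intro y hy
      obtain ⟨m, hm, rfl⟩ : y ∈ e.symm '' M := by simpa using hy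
      rw [← he]
      exact (h l).mp (Submodule.subset_span hl) m hm
    · intro y z _ _ hy hz
      rw [map_add]
      exact add_nonneg hy hz
    · rintro ⟨a, ha⟩ y _ hy
      rw [Nonneg.mk_smul, map_smul]
      exact mul_nonneg ha hy
  · intro hx
    by_contra hn
    obtain ⟨l, hl, hlx⟩ := exists_dual_neg_of_fg ⟨_, rfl⟩ hn
    have hlL : l ∈ hull ℝ L := (h l).mpr fun m hm => by
      rw [he]
      exact hl _ (Submodule.subset_span (by
        rw [Set.Finite.coe_toFinset]
        exact ⟨m, hm, rfl⟩))
    refine hlx.not_ge ?_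
    refine Submodule.span_induction (p := fun l _ => 0 ≤ l x) hx (by simp) ?_ ?_ hlL
    · intro y z _ _ hy hz
      exact add_nonneg hy hz
    · rintro ⟨a, ha⟩ y _ hy
      rw [Nonneg.mk_smul]
      exact mul_nonneg ha hy

/-- The image of a finite intersection of half-spaces under a linear map is a finitely generated
cone. -/
theorem exists_fg_map_of_finite_dual {L : Set (Module.Dual ℝ E)} (hL : L.Finite) (φ : E →ₗ[ℝ] F) :
    ∃ C : PointedCone ℝ F, C.FG ∧ ∀ y, y ∈ C ↔ ∃ x, (∀ l ∈ L, 0 ≤ l x) ∧ φ x = y := by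
  obtain ⟨S, hS⟩ := exists_hull_of_finite_dual hL
  refine ⟨(hull ℝ (S : Set E)).map φ, Submodule.FG.map _ ⟨S, rfl⟩, fun y => ?_⟩
  simp [mem_map, hS]

end PointedCone

namespace NPP

variable {V A K : Type*} [DecidableEq V] [Fintype A] [Fintype K] (N : NPP V A K)

/-- The homogenization of the epigraph of the follower's value function is finitely generated. -/
theorem exists_fg_cone [Finite V] : ∃ C : PointedCone ℝ (ℝ × N.Vec × ℝ), C.FG ∧
    ∀ s w z, (s, w, z) ∈ C ↔ 0 ≤ s ∧ 0 ≤ w ∧ ∃ x : K → A → ℝ, (∀ k, 0 ≤ x k) ∧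
      (∀ k, N.incMatrix *ᵥ x k = s • N.b k) ∧
      (∀ a : {a : A // a ∈ N.tolled}, ∑ k, x k a ≤ w a) ∧ ∑ k, N.c ⬝ᵥ x k ≤ z := by
  let E := ℝ × N.Vec × ℝ × (K → A → ℝ)
  let pS : Module.Dual ℝ E := LinearMap.fst ℝ _ _
  let pW : N.tolled → Module.Dual ℝ E :=
    fun a => LinearMap.proj a ∘ₗ LinearMap.fst ℝ _ _ ∘ₗ LinearMap.snd ℝ _ _
  let pZ : Module.Dual ℝ E := LinearMap.fst ℝ _ _ ∘ₗ LinearMap.snd ℝ _ _ ∘ₗ LinearMap.snd ℝ _ _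
  let pX : K → A → Module.Dual ℝ E := fun k a => LinearMap.proj a ∘ₗ LinearMap.proj k ∘ₗ
    LinearMap.snd ℝ _ _ ∘ₗ LinearMap.snd ℝ _ _ ∘ₗ LinearMap.snd ℝ _ _
  have eS : ∀ s w z x, pS (s, w, z, x) = s := fun _ _ _ _ => rfl
  have eW : ∀ a s w z x, pW a (s, w, z, x) = w a := fun _ _ _ _ _ => rfl
  have eZ : ∀ s w z x, pZ (s, w, z, x) = z := fun _ _ _ _ => rfl
  have eX : ∀ k a s w z x, pX k a (s, w, z, x) = x k a := fun _ _ _ _ _ _ => rfl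
  let pF : K × V → Module.Dual ℝ E :=
    fun i => (∑ a, N.incMatrix i.2 a • pX i.1 a) - N.b i.1 i.2 • pS
  -- Flow conservation is an equation, hence both `pF` and `-pF`.
  let L : Set (Module.Dual ℝ E) := {pS} ∪ (Set.range pW ∪
    (Set.range (fun i : K × A => pX i.1 i.2) ∪ (Set.range pF ∪ (Set.range (-pF) ∪
    (Set.range (fun a : N.tolled => pW a - ∑ k, pX k a) ∪
      {pZ - ∑ k, ∑ a, N.c a • pX k a})))))
  obtain ⟨C, hC, h⟩ := PointedCone.exists_fg_map_of_finite_dual (E := E)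
    (F := ℝ × N.Vec × ℝ) (L := L) (Set.toFinite L)
    (LinearMap.prodMap LinearMap.id (LinearMap.prodMap LinearMap.id (LinearMap.fst ℝ _ _)))
  refine ⟨C, hC, fun s w z => ?_⟩
  have key : ∀ s w z x, (∀ l ∈ L, 0 ≤ l (s, w, z, x)) ↔ 0 ≤ s ∧ 0 ≤ w ∧ (∀ k, 0 ≤ x k) ∧
      (∀ k, N.incMatrix *ᵥ x k = s • N.b k) ∧
      (∀ a : {a : A // a ∈ N.tolled}, ∑ k, x k a ≤ w a) ∧ ∑ k, N.c ⬝ᵥ x k ≤ z := by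
    intro s w z x
    have hF : ∀ i, pF i (s, w, z, x) = (N.incMatrix *ᵥ x i.1) i.2 - s * N.b i.1 i.2 := fun i => by
      simp [pF, eX, eS, Matrix.mulVec, dotProduct, mul_comm]
    simp only [L, Set.mem_union, or_imp, forall_and, Set.forall_mem_range, Set.mem_singleton_iff,
      forall_eq, Pi.neg_apply, LinearMap.neg_apply, hF]
    refine and_congr Iff.rfl (and_congr Iff.rfl (and_congr ?_ ?_))
    · exact ⟨fun h k a => h (k, a), fun h i => h i.1 i.2⟩
    · rw [← and_assoc]
      refine and_congr ⟨?_, ?_⟩ (and_congr ?_ ?_)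
      · rintro ⟨h1, h2⟩ k
        funext v
        have := h1 (k, v)
        have := h2 (k, v)
        simp only [Pi.smul_apply, smul_eq_mul]
        linarith
      · intro h
        constructor <;> rintro ⟨k, v⟩ <;> simp [h k]
      · simp [eW, eX]
      · simp [eZ, eX, dotProduct]
  rw [h]
  constructor
  · rintro ⟨⟨s', w', z', x⟩, hx, hy⟩
    obtain ⟨rfl, h⟩ := Prod.mk.inj hy
    obtain ⟨rfl, rfl⟩ := Prod.mk.inj h
    obtain ⟨h1, h2, h3⟩ := (key _ _ _ _).mp hx
    exact ⟨h1, h2, x, h3⟩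
  · rintro ⟨h1, h2, x, h3⟩
    exact ⟨(s, w, z, x), (key _ _ _ _).mpr ⟨h1, h2, h3⟩, rfl⟩

end NPP

/-! ### Weak duality, and optimality as equality in duality -/

namespace NPP

variable {V A K : Type*} [DecidableEq V] [Fintype A] [Fintype K] (N : NPP V A K)
variable {N} {t w : N.Vec} {x : K → A → ℝ} {m : ℝ}

theorem f_le_cost (h : N.Feasible w x) : N.f t ≤ (N.cost t w x : EReal) := by
  unfold f
  split_ifs
  · exact iInf_le_of_le w (iInf_le_of_le x (iInf_le _ h))
  · exact bot_le

theorem le_f (ht : 0 ≤ t) (h : ∀ w x, N.Feasible w x → m ≤ N.cost t w x) :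
    (m : EReal) ≤ N.f t := by
  rw [f, if_pos ht]
  exact le_iInf fun w => le_iInf fun x => le_iInf fun hx => EReal.coe_le_coe_iff.2 (h w x hx)

theorem nonneg_of_f_eq (h : N.f t = (m : EReal)) : 0 ≤ t := by
  by_contra ht
  rw [f, if_neg ht] at h
  exact EReal.bot_ne_coe _ h

theorem le_g (h : (m : EReal) ≤ N.f t) : ((m - t ⬝ᵥ w : ℝ) : EReal) ≤ N.g w := by
  refine le_trans ?_ (le_iSup _ t)
  rw [EReal.coe_sub]
  exact EReal.sub_le_sub h le_rfl

theorem g_le (h : ∀ t, 0 ≤ t → N.f t ≤ ((m + t ⬝ᵥ w : ℝ) : EReal)) : N.g w ≤ (m : EReal) := by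
  refine iSup_le fun t => ?_
  by_cases ht : 0 ≤ t
  · have := EReal.sub_le_sub (h t ht) (le_refl ((t ⬝ᵥ w : ℝ) : EReal))
    rwa [← EReal.coe_sub, add_sub_cancel_right] at this
  · rw [f, if_neg ht, EReal.bot_sub]
    exact bot_le

theorem g_le_cost (h : N.Feasible w x) : N.g w ≤ ((∑ k, N.c ⬝ᵥ x k : ℝ) : EReal) :=
  g_le fun _ _ => f_le_cost h

theorem g_antitone {w' : N.Vec} (h : w ≤ w') : N.g w' ≤ N.g w := by
  refine iSup_le fun t => le_iSup_of_le t ?_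
  by_cases ht : 0 ≤ t
  · exact EReal.sub_le_sub le_rfl
      (EReal.coe_le_coe_iff.2 (dotProduct_le_dotProduct_of_nonneg_left h ht))
  · rw [f, if_neg ht, EReal.bot_sub, EReal.bot_sub]

theorem Feasible.mono {w' : N.Vec} (h : N.Feasible w x) (hw : w ≤ w') : N.Feasible w' x :=
  ⟨fun a => (h.1 a).trans (hw a), h.2.1, h.2.2.1.trans hw, h.2.2.2⟩

/-- Each coordinate of an optimal `w` can be raised without losing feasibility, so a negative toll
would make the cost drop. -/
theorem nonneg_of_mem_optW (h : w ∈ N.optW t) : 0 ≤ t := by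
  classical
  obtain ⟨x, hx, hmin⟩ := h
  intro a
  have := hmin (w + Pi.single a 1) x
    (hx.mono (le_add_of_nonneg_right (Pi.single_nonneg.2 zero_le_one)))
  simpa [cost, dotProduct_add] using this

theorem f_eq_of_mem_optW (h : w ∈ N.optW t) : ∃ m : ℝ, N.f t = (m : EReal) ∧
    N.g w = ((m - t ⬝ᵥ w : ℝ) : EReal) := by
  have ht := nonneg_of_mem_optW h
  obtain ⟨x, hx, hmin⟩ := h
  have hf : N.f t = (N.cost t w x : EReal) := le_antisymm (f_le_cost hx) (le_f ht hmin)
  refine ⟨_, hf, le_antisymm ?_ (le_g hf.ge)⟩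
  convert g_le_cost hx using 2
  simp [cost]

/-- The reverse direction is strong duality with attainment: the slice `s = 1` of the finitely
generated cone consists of the `(w, z)` served by a flow of base cost at most `z`. If the value `m -
t ⬝ᵥ w` were not attained, Farkas' lemma would yield tolls forcing `g w` above it. -/
theorem mem_optW_iff [Finite V] : w ∈ N.optW t ↔ ∃ m : ℝ, N.f t = (m : EReal) ∧
    N.g w = ((m - t ⬝ᵥ w : ℝ) : EReal) := by
  classical
  refine ⟨f_eq_of_mem_optW, ?_⟩
  rintro ⟨m, hf, hg⟩
  have ht := nonneg_of_f_eq hf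
  have hm : ∀ w x, N.Feasible w x → m ≤ N.cost t w x := fun w x hx =>
    EReal.coe_le_coe_iff.1 (hf ▸ f_le_cost hx)
  obtain ⟨C, hC, h⟩ := N.exists_fg_cone
  by_cases hmem : (1, w, m - t ⬝ᵥ w) ∈ C
  · obtain ⟨-, hw, x, hx0, hx1, hx2, hx3⟩ := (h _ _ _).1 hmem
    refine ⟨x, ⟨hx2, fun k => by rw [hx1, one_smul], hw, hx0⟩, fun w' x' h' => ?_⟩
    refine le_trans ?_ (hm w' x' h')
    unfold cost
    linarith
  · exfalso
    obtain ⟨l, hl, hlt⟩ := PointedCone.exists_dual_neg_of_fg hC hmem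
    set σ := l (1, 0, 0) with hσ
    set τ : N.Vec := fun a => l (0, Pi.single a 1, 0) with hτ
    set ζ := l (0, 0, 1) with hζ
    have hlin : ∀ s w z, l (s, w, z) = s * σ + τ ⬝ᵥ w + z * ζ := by
      intro s w z
      have h1 : (s, w, z) = s • ((1, 0, 0) : ℝ × N.Vec × ℝ) +
          ∑ a, w a • ((0, Pi.single a 1, 0) : ℝ × N.Vec × ℝ) + z • (0, 0, 1) := by
        ext
        · simp [Prod.fst_sum]
        · simp [Prod.fst_sum, Prod.snd_sum, Finset.sum_apply, Pi.single_apply]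
        · simp [Prod.snd_sum]
      rw [h1]
      simp only [map_add, map_sum, map_smul, smul_eq_mul, dotProduct, hσ, hτ, hζ, mul_comm]
    have hτ0 : 0 ≤ τ := fun a => hl _ ((h _ _ _).2
      ⟨le_rfl, Pi.single_nonneg.2 zero_le_one, 0, by simp, by simp, fun b => by
        simpa using (Pi.single_nonneg.2 zero_le_one : (0 : N.Vec) ≤ Pi.single a 1) b, by simp⟩)
    have hζ0 : 0 ≤ ζ := hl _ ((h _ _ _).2 ⟨le_rfl, le_rfl, 0, by simp, by simp, by simp, by simp⟩)
    -- The separating functional may have `ζ = 0`. Adding the valid inequality `m ≤ cost` at `t`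
    -- makes the coefficient of the cost positive, so that normalizing gives genuine tolls.
    have hpos : 0 < 1 + ζ := by linarith
    have hf' : (((1 + ζ)⁻¹ * (m - σ) : ℝ) : EReal) ≤ N.f ((1 + ζ)⁻¹ • (t + τ)) := by
      refine le_f (smul_nonneg (inv_nonneg.2 hpos.le) (add_nonneg ht hτ0)) fun w' x' h' => ?_
      have h1 := hm w' x' h'
      have h2 := hl _ ((h 1 w' (∑ k, N.c ⬝ᵥ x' k)).2
        ⟨zero_le_one, h'.2.2.1, x', h'.2.2.2, fun k => by rw [one_smul, h'.2.1], h'.1, le_rfl⟩)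
      rw [hlin] at h2
      unfold cost at h1 ⊢
      rw [smul_dotProduct, add_dotProduct, inv_mul_le_iff₀ hpos, mul_add, smul_eq_mul,
        mul_inv_cancel_left₀ hpos.ne']
      linarith
    have hg' := le_g (w := w) hf'
    rw [hg, EReal.coe_le_coe_iff, smul_dotProduct, add_dotProduct, smul_eq_mul, ← mul_sub,
      inv_mul_le_iff₀ hpos] at hg'
    rw [hlin] at hlt
    linarith

end NPP

/-! ### Epigraph faces, relative interiors and graphs -/

/-- Epigraphs are closed upwards, so an exposing functional is nonpositive on `(0, 1)`; were it zero
there, the face would contain a vertical segment. Dividing by this negative value turns maximizing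
it into minimizing `z + w ⬝ᵥ y`. -/
theorem isNonverticalFace_epi_iff {ι : Type*} [Fintype ι] {φ : (ι → ℝ) → EReal}
    {F : Set ((ι → ℝ) × ℝ)} : IsNonverticalFace (epi φ) F ↔ F.Nonempty ∧ ∃ (w : ι → ℝ) (m : ℝ),
      (∀ (y : ι → ℝ) (z : ℝ), φ y ≤ (z : EReal) → m ≤ z + w ⬝ᵥ y) ∧
        F = {p | φ p.1 ≤ (p.2 : EReal) ∧ p.2 + w ⬝ᵥ p.1 = m} := by
  classical
  constructor
  · rintro ⟨hexp, hne, hdir⟩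
    refine ⟨hne, ?_⟩
    obtain ⟨l, hl⟩ := hexp hne
    obtain ⟨⟨y₀, z₀⟩, h₀⟩ := hne
    have h₀' := h₀
    rw [hl] at h₀'
    have hup : (y₀, z₀ + 1) ∈ epi φ :=
      h₀'.1.trans (EReal.coe_le_coe_iff.2 (le_add_of_nonneg_right zero_le_one))
    have hadd : ((y₀, z₀ + 1) : (ι → ℝ) × ℝ) = (y₀, z₀) + (0, 1) := by simp
    have hs : l (0, 1) < 0 := by
      have h1 := h₀'.2 _ hup
      rw [hadd, map_add] at h1
      refine lt_of_le_of_ne (by linarith) fun h0 => hdir ?_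
      have h2 : (y₀, z₀ + 1) ∈ F := by
        rw [hl]
        refine ⟨hup, fun y hy => ?_⟩
        rw [hadd, map_add, h0, add_zero]
        exact h₀'.2 y hy
      have := vsub_mem_vectorSpan ℝ h2 h₀
      rw [direction_affineSpan]
      simpa using this
    set σ := l (0, 1) with hσ
    let w : ι → ℝ := fun i => l (Pi.single i 1, 0) / σ
    have hlin : ∀ p : (ι → ℝ) × ℝ, l p = σ * (p.2 + w ⬝ᵥ p.1) := by
      rintro ⟨y, z⟩
      have h1 : ((y, z) : (ι → ℝ) × ℝ) =
          ∑ i, y i • ((Pi.single i 1, 0) : (ι → ℝ) × ℝ) + z • (0, 1) := by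
        ext
        · simp [Prod.fst_sum, Finset.sum_apply, Pi.single_apply]
        · simp [Prod.snd_sum]
      conv_lhs => rw [h1]
      simp only [map_add, map_sum, map_smul, smul_eq_mul, ← hσ, dotProduct, w, mul_add,
        Finset.mul_sum]
      rw [add_comm, mul_comm]
      congr 1
      refine Finset.sum_congr rfl fun i _ => ?_
      have := hs.ne
      field_simp
    refine ⟨w, z₀ + w ⬝ᵥ y₀, fun y z hyz => ?_, ?_⟩
    · have := h₀'.2 (y, z) hyz
      rw [hlin, hlin] at this
      exact (mul_le_mul_left_of_neg hs).1 this
    · ext p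
      constructor
      · intro hp
        rw [hl] at hp
        refine ⟨hp.1, ?_⟩
        have h1 := hp.2 _ h₀'.1
        have h2 := h₀'.2 _ hp.1
        have h3 := le_antisymm h1 h2
        rw [hlin, hlin] at h3
        exact (mul_left_cancel₀ hs.ne h3).symm
      · rintro ⟨hp, he⟩
        rw [hl]
        refine ⟨hp, fun y hy => ?_⟩
        have := h₀'.2 y hy
        rwa [hlin (y₀, z₀), ← he, ← hlin] at this
  · rintro ⟨hne, w, m, hm, rfl⟩
    let l : (ι → ℝ) × ℝ →ₗ[ℝ] ℝ :=
      LinearMap.snd ℝ _ _ + dotProductEquiv ℝ ι w ∘ₗ LinearMap.fst ℝ _ _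
    have hl : ∀ p, l p = p.2 + w ⬝ᵥ p.1 := fun p => rfl
    refine ⟨fun _ => ⟨LinearMap.toContinuousLinearMap (-l), ?_⟩, hne, fun hdir => ?_⟩
    · obtain ⟨p₀, hp₀, he₀⟩ := hne
      ext p
      constructor
      · rintro ⟨hp, he⟩
        refine ⟨hp, fun y hy => ?_⟩
        simp only [LinearMap.coe_toContinuousLinearMap', LinearMap.neg_apply, hl, he]
        exact neg_le_neg (hm _ _ hy)
      · rintro ⟨hp, hmax⟩
        refine ⟨hp, le_antisymm ?_ (hm _ _ hp)⟩
        have := hmax p₀ hp₀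
        simp only [LinearMap.coe_toContinuousLinearMap', LinearMap.neg_apply, hl, he₀] at this
        linarith
    · rw [direction_affineSpan] at hdir
      have : vectorSpan ℝ {p : (ι → ℝ) × ℝ | φ p.1 ≤ (p.2 : EReal) ∧ p.2 + w ⬝ᵥ p.1 = m} ≤
          LinearMap.ker l := by
        refine Submodule.span_le.2 ?_
        rintro _ ⟨p, hp, q, hq, rfl⟩
        have : l (p - q) = 0 := by rw [map_sub, hl, hl, hp.2, hq.2, sub_self]
        exact this
      have := this hdir
      simp [hl] at this

/-- The line through `q` and `p` stays in the affine span, where `p` is an interior point, so the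
segment can be prolonged past `p`. -/
theorem exists_add_smul_mem_of_mem_intrinsicInterior {E : Type*} [NormedAddCommGroup E]
    [NormedSpace ℝ E] {s : Set E} {p q : E} (hp : p ∈ intrinsicInterior ℝ s) (hq : q ∈ s) :
    ∃ ε > (0 : ℝ), p + ε • (p - q) ∈ s := by
  obtain ⟨p', hp', rfl⟩ := hp
  let γ : ℝ → affineSpan ℝ s := fun δ => ⟨AffineMap.lineMap q (p' : E) (1 + δ),
    AffineMap.lineMap_mem _ (subset_affineSpan ℝ s hq) p'.2⟩
  have hγ : Continuous γ := by
    refine Continuous.subtype_mk ?_ _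
    simp only [AffineMap.lineMap_apply_module]
    fun_prop
  have h0 : γ 0 = p' := Subtype.ext (by simp [γ])
  have hmem : γ ⁻¹' ((↑) ⁻¹' s) ∈ nhds (0 : ℝ) := by
    refine hγ.continuousAt.preimage_mem_nhds ?_
    rw [h0]
    exact mem_interior_iff_mem_nhds.1 hp'
  obtain ⟨ε, hε, h⟩ := Metric.mem_nhds_iff.1 hmem
  refine ⟨ε / 2, half_pos hε, ?_⟩
  have := h (show ε / 2 ∈ Metric.ball (0 : ℝ) ε by
    rw [Metric.mem_ball, Real.dist_eq, sub_zero, abs_of_pos (half_pos hε)]; linarith)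
  have e : (p' : E) + (ε / 2) • ((p' : E) - q) = (γ (ε / 2) : E) := by
    simp only [γ, AffineMap.lineMap_apply_module]
    module
  rw [e]
  exact this

theorem affDim_setOf_mem_and_eq {E : Type*} [AddCommGroup E] [Module ℝ E] (S : Set E)
    (a : E →ₗ[ℝ] ℝ) (b : ℝ) : affDim {p : E × ℝ | p.1 ∈ S ∧ p.2 = a p.1 + b} = affDim S := by
  let φ : E →ᵃ[ℝ] E × ℝ := (LinearMap.id.prod a).toAffineMap + AffineMap.const ℝ E (0, b)
  have h : {p : E × ℝ | p.1 ∈ S ∧ p.2 = a p.1 + b} = φ '' S := by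
    ext ⟨y, z⟩
    simp only [φ, Set.mem_ofPred_eq, Set.mem_image, AffineMap.coe_add, Pi.add_apply]
    constructor
    · rintro ⟨hy, rfl⟩
      exact ⟨y, hy, by simp⟩
    · rintro ⟨y', hy, he⟩
      simp only [LinearMap.coe_toAffineMap, LinearMap.prod_apply, Function.prod_apply,
        LinearMap.id_apply, AffineMap.const_apply, Prod.mk_add_mk, add_zero, Prod.mk.injEq] at he
      obtain ⟨rfl, rfl⟩ := he
      exact ⟨hy, rfl⟩
  have hφ : φ.linear = LinearMap.id.prod a := by ext <;> simp [φ]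
  rw [h, affDim, affDim, direction_affineSpan, direction_affineSpan,
    ← AffineMap.map_vectorSpan, hφ]
  exact (Submodule.equivMapOfInjective _
    (fun y y' h => (Prod.mk.inj h).1) (vectorSpan ℝ S)).finrank_eq.symm

/-! ### Relatively interior points and complementary dimensions -/

namespace NPP

theorem cost_convexComb {V A K : Type*} [Fintype A] [Fintype K] {N : NPP V A K}
    (t w w' : N.Vec) (x x' : K → A → ℝ) (a b : ℝ) :
    N.cost t (a • w + b • w') (a • x + b • x') = a * N.cost t w x + b * N.cost t w' x' := by
  simp only [cost, Pi.add_apply, Pi.smul_apply, dotProduct_add, dotProduct_smul,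
    Finset.sum_add_distrib, smul_eq_mul, ← Finset.mul_sum]
  ring

variable {V A K : Type*} [DecidableEq V] [Fintype A] [Fintype K] {N : NPP V A K}

theorem Feasible.convexComb {w w' : N.Vec} {x x' : K → A → ℝ} {a b : ℝ} (h : N.Feasible w x)
    (h' : N.Feasible w' x') (ha : 0 ≤ a) (hb : 0 ≤ b) (hab : a + b = 1) :
    N.Feasible (a • w + b • w') (a • x + b • x') := by
  refine ⟨fun i => ?_, fun k => ?_, add_nonneg (smul_nonneg ha h.2.2.1) (smul_nonneg hb h'.2.2.1),
    fun k => add_nonneg (smul_nonneg ha (h.2.2.2 k)) (smul_nonneg hb (h'.2.2.2 k))⟩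
  · simp only [Pi.add_apply, Pi.smul_apply, smul_eq_mul, Finset.sum_add_distrib, ← Finset.mul_sum]
    exact add_le_add (mul_le_mul_of_nonneg_left (h.1 i) ha) (mul_le_mul_of_nonneg_left (h'.1 i) hb)
  · simp only [Pi.add_apply, Pi.smul_apply, Matrix.mulVec_add, Matrix.mulVec_smul, h.2.1, h'.2.1,
      ← add_smul, hab, one_smul]

theorem convex_optW (t : N.Vec) : Convex ℝ (N.optW t) := by
  rintro w ⟨x, hx, hmin⟩ w' ⟨x', hx', hmin'⟩ a b ha hb hab
  refine ⟨_, hx.convexComb hx' ha hb hab, fun v y hy => ?_⟩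
  rw [cost_convexComb]
  calc a * N.cost t w x + b * N.cost t w' x' ≤ a * N.cost t v y + b * N.cost t v y :=
        add_le_add (mul_le_mul_of_nonneg_left (hmin v y hy) ha)
          (mul_le_mul_of_nonneg_left (hmin' v y hy) hb)
    _ = N.cost t v y := by rw [← add_mul, hab, one_mul]

theorem convex_setOf_mem_optW (w : N.Vec) : Convex ℝ {t | w ∈ N.optW t} := by
  rintro t ⟨x, hx, hmin⟩ t' ⟨x', hx', hmin'⟩ a b ha hb hab
  refine ⟨x, hx, fun v y hy => ?_⟩
  have h1 := hmin v y hy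
  have h2 := hmin' v y hy
  -- The flows `x` and `x'` may differ, but each is optimal for the same `w`, so their base costs
  -- agree and `x` serves both tolls.
  have h3 := hmin w x' hx'
  have h4 := hmin' w x hx
  simp only [cost, add_dotProduct, smul_dotProduct, smul_eq_mul] at h1 h2 h3 h4 ⊢
  have h5 := mul_le_mul_of_nonneg_left h1 ha
  have h6 := mul_le_mul_of_nonneg_left h2 hb
  have h7 : ∑ k, N.c ⬝ᵥ x k = ∑ k, N.c ⬝ᵥ x' k := by linarith
  rw [← h7] at h6
  obtain rfl : b = 1 - a := by linarith
  linarith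

variable [Finite V]

/-- If `t₀` is relatively interior to an action set, then reactions optimal at `t₀` are optimal
on the whole action set. -/
theorem mem_optW_of_mem_intrinsicInterior {t t₀ w w₀ : N.Vec}
    (h₀ : t₀ ∈ intrinsicInterior ℝ {t | w₀ ∈ N.optW t}) (hw : w ∈ N.optW t₀)
    (ht : w₀ ∈ N.optW t) : w ∈ N.optW t := by
  -- On `{t | w₀ ∈ N.optW t}` one has `f t = g w₀ + t ⬝ᵥ w₀`, so the gap of `w` is affine in the
  -- tolls. It is nonnegative at `t` and at the prolonged point, and zero at `t₀` between them.
  obtain ⟨ε, hε, ht'⟩ := exists_add_smul_mem_of_mem_intrinsicInterior h₀ ht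
  obtain ⟨m₀, hf₀, hg₀⟩ := mem_optW_iff.1
    (show w₀ ∈ N.optW t₀ from intrinsicInterior_subset (s := {t | w₀ ∈ N.optW t}) h₀)
  obtain ⟨m, hf, hg⟩ := mem_optW_iff.1 ht
  obtain ⟨m', hf', hg'⟩ := mem_optW_iff.1 ht'
  obtain ⟨m₁, hf₁, hgw⟩ := mem_optW_iff.1 hw
  refine mem_optW_iff.2 ⟨m, hf, ?_⟩
  have e₁ := EReal.coe_injective (hf₀.symm.trans hf₁)
  have e₂ := EReal.coe_injective (hg₀.symm.trans hg)
  have e₃ := EReal.coe_injective (hg₀.symm.trans hg')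
  have i := le_g (w := w) hf.ge
  have i' := le_g (w := w) hf'.ge
  rw [hgw, EReal.coe_le_coe_iff] at i i'
  rw [hgw, EReal.coe_eq_coe_iff]
  refine le_antisymm ?_ i
  simp only [add_dotProduct, smul_dotProduct, sub_dotProduct, smul_eq_mul] at i' e₃
  refine le_of_mul_le_mul_left ?_ hε
  have e : m = m₁ - t₀ ⬝ᵥ w₀ + t ⬝ᵥ w₀ := by linarith
  rw [e]
  linarith

/-- If `w₀` is relatively interior to a reaction set, then tolls at which `w₀` is optimal make the
whole reaction set optimal. -/
theorem mem_optW_of_mem_intrinsicInterior' {t t₀ w w₀ : N.Vec}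
    (h₀ : w₀ ∈ intrinsicInterior ℝ (N.optW t₀)) (hw : w ∈ N.optW t₀)
    (ht : w₀ ∈ N.optW t) : w ∈ N.optW t := by
  -- On `N.optW t₀` the function `g` is affine, so the gap at `t` is affine in the reaction; it is
  -- nonnegative at both ends and zero at `w₀`.
  obtain ⟨ε, hε, hw'⟩ := exists_add_smul_mem_of_mem_intrinsicInterior h₀ hw
  obtain ⟨m₀, hf₀, hg₀⟩ := mem_optW_iff.1 (intrinsicInterior_subset h₀)
  obtain ⟨m, hf, hg⟩ := mem_optW_iff.1 ht
  obtain ⟨m', hf', hg'⟩ := mem_optW_iff.1 hw'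
  obtain ⟨m₁, hf₁, hgw⟩ := mem_optW_iff.1 hw
  refine mem_optW_iff.2 ⟨m, hf, ?_⟩
  have e₁ := EReal.coe_injective (hf₀.symm.trans hf₁)
  have e₂ := EReal.coe_injective (hg₀.symm.trans hg)
  have e₃ := EReal.coe_injective (hf₀.symm.trans hf')
  have i := le_g (w := w) hf.ge
  have i' := le_g (w := w₀ + ε • (w₀ - w)) hf.ge
  rw [hgw, EReal.coe_le_coe_iff] at i
  rw [hg', EReal.coe_le_coe_iff] at i'
  rw [hgw, EReal.coe_eq_coe_iff]
  refine le_antisymm ?_ i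
  simp only [dotProduct_add, dotProduct_smul, dotProduct_sub, smul_eq_mul] at i'
  refine le_of_mul_le_mul_left ?_ hε
  have e : m = m₁ - t₀ ⬝ᵥ w₀ + t ⬝ᵥ w₀ := by linarith
  rw [e] at i' ⊢
  linarith

/-- Moving the tolls slightly in a direction that is constant on the optimal reactions preserves
optimality. -/
theorem exists_mem_optW_add_smul {t₀ w₀ d : N.Vec} (h₀ : w₀ ∈ N.optW t₀)
    (hd : ∀ w ∈ N.optW t₀, d ⬝ᵥ w = d ⬝ᵥ w₀) : ∃ ε > (0 : ℝ), w₀ ∈ N.optW (t₀ + ε • d) := by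
  obtain ⟨C, ⟨S, rfl⟩, h⟩ := N.exists_fg_cone
  set C := PointedCone.hull ℝ (S : Set (ℝ × N.Vec × ℝ)) with hC
  obtain ⟨x₀, hx₀, hmin⟩ := h₀
  set z₀ := ∑ k, N.c ⬝ᵥ x₀ k with hz₀
  have hcost : ∀ t, N.cost t w₀ x₀ = z₀ + t ⬝ᵥ w₀ := fun t => rfl
  have mem : ∀ w x, N.Feasible w x → (1, w, ∑ k, N.c ⬝ᵥ x k) ∈ C := fun w x hx =>
    (h _ _ _).2 ⟨zero_le_one, hx.2.2.1, x, hx.2.2.2, fun k => by rw [one_smul, hx.2.1], hx.1,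
      le_rfl⟩
  have key : ∀ y ∈ C, 0 ≤ y.2.2 + t₀ ⬝ᵥ y.2.1 - y.1 * (z₀ + t₀ ⬝ᵥ w₀) ∧
      (y.2.2 + t₀ ⬝ᵥ y.2.1 - y.1 * (z₀ + t₀ ⬝ᵥ w₀) = 0 → d ⬝ᵥ y.2.1 - y.1 * (d ⬝ᵥ w₀) = 0) := by
    -- The first expression is the reduced cost of `y` at `t₀`. Adding the optimal point and
    -- rescaling to `s = 1` also treats recession directions; reduced cost zero makes the rescaled
    -- point optimal, where `hd` applies.
    rintro ⟨s, w, z⟩ hy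
    have hs : 0 ≤ s := ((h _ _ _).1 hy).1
    have hs1 : 0 < 1 + s := by linarith
    have hy' := PointedCone.smul_mem C (inv_nonneg.2 hs1.le) (C.add_mem (mem w₀ x₀ hx₀) hy)
    simp only [Prod.mk_add_mk, Prod.smul_mk, smul_eq_mul, inv_mul_cancel₀ hs1.ne'] at hy'
    obtain ⟨-, hw, x, hx, hb, hle, hc⟩ := (h _ _ _).1 hy'
    rw [← hz₀] at hc
    have hfeas : N.Feasible ((1 + s)⁻¹ • (w₀ + w)) x :=
      ⟨hle, fun k => by rw [hb, one_smul], hw, hx⟩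
    have h1 : N.cost t₀ ((1 + s)⁻¹ • (w₀ + w)) x ≤
        (1 + s)⁻¹ * (z₀ + z + (t₀ ⬝ᵥ w₀ + t₀ ⬝ᵥ w)) := by
      rw [cost, dotProduct_smul, dotProduct_add, smul_eq_mul]
      linarith
    have h2 := (hmin _ _ hfeas).trans h1
    rw [hcost, le_inv_mul_iff₀ hs1] at h2
    refine ⟨by simp only; linarith, fun he => ?_⟩
    simp only at he ⊢
    have h3 : (1 + s)⁻¹ • (w₀ + w) ∈ N.optW t₀ := by
      refine ⟨x, hfeas, fun w' x' h' => h1.trans (le_trans ?_ (hmin w' x' h'))⟩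
      rw [hcost, inv_mul_le_iff₀ hs1]
      linarith
    have h4 := hd _ h3
    rw [dotProduct_smul, dotProduct_add, smul_eq_mul, inv_mul_eq_iff_eq_mul₀ hs1.ne'] at h4
    linarith
  -- On generators with zero reduced cost the perturbation vanishes, on the others it is small
  -- against a positive number. As there are finitely many, one `ε` works for all of them, hence on
  -- the cone.
  have hev : ∀ᶠ ε in nhdsWithin (0 : ℝ) (Set.Ioi 0), ∀ y ∈ S,
      0 ≤ (y.2.2 + t₀ ⬝ᵥ y.2.1 - y.1 * (z₀ + t₀ ⬝ᵥ w₀)) +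
        ε * (d ⬝ᵥ y.2.1 - y.1 * (d ⬝ᵥ w₀)) := by
    rw [Filter.eventually_all_finset]
    intro y hy
    obtain ⟨h1, h2⟩ := key y (Submodule.subset_span hy)
    rcases h1.eq_or_lt with h1 | h1
    · rw [← h1, h2 h1.symm]
      simp
    · refine nhdsWithin_le_nhds ?_
      refine (ContinuousAt.eventually_lt (f := fun _ => (0 : ℝ)) (by fun_prop)
        (by fun_prop) (by simpa using h1)).mono fun ε hε => le_of_lt hε
  obtain ⟨ε, hε, hpos⟩ := (hev.and self_mem_nhdsWithin).exists
  refine ⟨ε, hpos, x₀, hx₀, fun w x hx => ?_⟩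
  have hall : ∀ y ∈ C, 0 ≤ (y.2.2 + t₀ ⬝ᵥ y.2.1 - y.1 * (z₀ + t₀ ⬝ᵥ w₀)) +
        ε * (d ⬝ᵥ y.2.1 - y.1 * (d ⬝ᵥ w₀)) := by
    intro y hy
    refine Submodule.span_induction (p := fun (y : ℝ × N.Vec × ℝ) _ =>
      0 ≤ (y.2.2 + t₀ ⬝ᵥ y.2.1 - y.1 * (z₀ + t₀ ⬝ᵥ w₀)) +
        ε * (d ⬝ᵥ y.2.1 - y.1 * (d ⬝ᵥ w₀))) (fun y hy => hε y hy) (by simp) ?_ ?_ hy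
    · intro y y' _ _ h1 h2
      simp only [Prod.fst_add, Prod.snd_add, dotProduct_add]
      linarith
    · rintro ⟨a, ha⟩ y _ h1
      have := mul_nonneg ha h1
      simp only [Nonneg.mk_smul, Prod.smul_fst, Prod.smul_snd, dotProduct_smul, smul_eq_mul]
      linarith
  have := hall _ (mem w x hx)
  rw [hcost]
  simp only [cost, add_dotProduct, smul_dotProduct, smul_eq_mul] at this ⊢
  linarith

theorem setW_setOf_mem_optW {t₀ w₀ : N.Vec}
    (h₀ : t₀ ∈ intrinsicInterior ℝ {t | w₀ ∈ N.optW t}) :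
    N.setW {t | w₀ ∈ N.optW t} = N.optW t₀ := by
  refine Set.Subset.antisymm (Set.iInter₂_subset t₀ (intrinsicInterior_subset h₀)) fun w hw => ?_
  exact Set.mem_iInter₂.2 fun t ht => mem_optW_of_mem_intrinsicInterior h₀ hw ht

/-- The two direction spaces are orthogonal complements of each other. -/
theorem affDim_add_affDim_optW {t₀ w₀ : N.Vec}
    (h₀ : t₀ ∈ intrinsicInterior ℝ {t | w₀ ∈ N.optW t}) :
    affDim {t | w₀ ∈ N.optW t} + affDim (N.optW t₀) = N.tolled.card := by
  classical
  have hw₀ : w₀ ∈ N.optW t₀ := intrinsicInterior_subset (s := {t | w₀ ∈ N.optW t}) h₀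
  have hmap : (vectorSpan ℝ {t | w₀ ∈ N.optW t}).map
      (dotProductEquiv ℝ {a : A // a ∈ N.tolled}).toLinearMap =
        (vectorSpan ℝ (N.optW t₀)).dualAnnihilator := by
    refine le_antisymm ?_ fun φ hφ => ?_
    · rw [Submodule.map_le_iff_le_comap]
      refine Submodule.span_le.2 ?_
      rintro _ ⟨t, ht, t', ht', rfl⟩
      refine (Submodule.mem_dualAnnihilator _).2 fun e he => ?_
      suffices h : vectorSpan ℝ (N.optW t₀) ≤
          LinearMap.ker (dotProductEquiv ℝ {a : A // a ∈ N.tolled} (t - t')) from h he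
      refine Submodule.span_le.2 ?_
      rintro _ ⟨w, hw, w', hw', rfl⟩
      -- The four duality equalities at `t, t'` and `w, w'` combine to `(t - t') ⬝ᵥ (w - w') = 0`.
      obtain ⟨m₁, hf₁, hg₁⟩ := mem_optW_iff.1 (mem_optW_of_mem_intrinsicInterior h₀ hw ht)
      obtain ⟨m₂, hf₂, hg₂⟩ := mem_optW_iff.1 (mem_optW_of_mem_intrinsicInterior h₀ hw ht')
      obtain ⟨m₃, hf₃, hg₃⟩ := mem_optW_iff.1 (mem_optW_of_mem_intrinsicInterior h₀ hw' ht)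
      obtain ⟨m₄, hf₄, hg₄⟩ := mem_optW_iff.1 (mem_optW_of_mem_intrinsicInterior h₀ hw' ht')
      have e₁ := EReal.coe_injective (hf₁.symm.trans hf₃)
      have e₂ := EReal.coe_injective (hf₂.symm.trans hf₄)
      have e₃ := EReal.coe_injective (hg₁.symm.trans hg₂)
      have e₄ := EReal.coe_injective (hg₃.symm.trans hg₄)
      simp only [SetLike.mem_coe, LinearMap.mem_ker, dotProductEquiv_apply_apply, vsub_eq_sub,
        sub_dotProduct, dotProduct_sub]
      linarith
    · obtain ⟨d, rfl⟩ := (dotProductEquiv ℝ {a : A // a ∈ N.tolled}).surjective φ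
      refine ⟨d, ?_, rfl⟩
      obtain ⟨ε, hε, hmem⟩ := exists_mem_optW_add_smul (d := d) hw₀ fun w hw => by
        have := (Submodule.mem_dualAnnihilator _).1 hφ _ (vsub_mem_vectorSpan ℝ hw hw₀)
        rw [dotProductEquiv_apply_apply, vsub_eq_sub, dotProduct_sub] at this
        linarith
      have := vsub_mem_vectorSpan ℝ (show t₀ + ε • d ∈ {t | w₀ ∈ N.optW t} from hmem)
        (show t₀ ∈ {t | w₀ ∈ N.optW t} from hw₀)
      rw [vsub_eq_sub, add_sub_cancel_left] at this
      exact (Submodule.smul_mem_iff _ hε.ne').1 this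
  rw [affDim, affDim, direction_affineSpan, direction_affineSpan,
    ← LinearEquiv.finrank_map_eq (dotProductEquiv ℝ {a : A // a ∈ N.tolled}), add_comm]
  have := Subspace.finrank_add_finrank_dualAnnihilator_eq (vectorSpan ℝ (N.optW t₀))
  rw [← hmap] at this
  rw [this]
  simp

end NPP

/-! ### Faces of the two epigraphs as graphs over optimality sets -/

namespace NPP

variable {V A K : Type*} [DecidableEq V] [Fintype A] [Fintype K] {N : NPP V A K}
variable {t w : N.Vec} {m γ : ℝ}

/-- The part of the graph of `-f` above `T`. -/
def liftF (N : NPP V A K) (T : Set N.Vec) : Set (N.Vec × ℝ) :=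
  {p | p.1 ∈ T ∧ N.f p.1 = ((-p.2 : ℝ) : EReal)}

theorem f_le_of_g_le (h : N.g w ≤ (γ : EReal)) : N.f t ≤ ((γ + t ⬝ᵥ w : ℝ) : EReal) := by
  by_contra hlt
  -- A priori `f t` may be infinite, so the comparison goes through a real number strictly in
  -- between.
  obtain ⟨q, hq, hqf⟩ := EReal.lt_iff_exists_real_btwn.1 (not_le.1 hlt)
  have := (le_g (w := w) hqf.le).trans h
  rw [EReal.coe_le_coe_iff] at this
  rw [EReal.coe_lt_coe_iff] at hq
  linarith

theorem neg_f_le_iff {z : ℝ} : (-N.f) t ≤ (z : EReal) ↔ ((-z : ℝ) : EReal) ≤ N.f t := by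
  rw [Pi.neg_apply, EReal.neg_le, EReal.coe_neg]

theorem forall_neg_f_le_iff : (∀ (t : N.Vec) (z : ℝ), (-N.f) t ≤ (z : EReal) → m ≤ z + w ⬝ᵥ t) ↔
    N.g w ≤ ((-m : ℝ) : EReal) := by
  constructor
  · refine fun h => g_le fun t _ => ?_
    by_contra hlt
    obtain ⟨q, hq, hqf⟩ := EReal.lt_iff_exists_real_btwn.1 (not_le.1 hlt)
    have := h t (-q) (neg_f_le_iff.2 (by rw [neg_neg]; exact hqf.le))
    rw [EReal.coe_lt_coe_iff, dotProduct_comm] at hq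
    linarith
  · intro h t z hz
    have := (neg_f_le_iff.1 hz).trans (f_le_of_g_le h)
    rw [EReal.coe_le_coe_iff, dotProduct_comm] at this
    linarith

theorem setOf_neg_f_le_and_eq [Finite V] (h : N.g w = ((-m : ℝ) : EReal)) :
    {p : N.Vec × ℝ | (-N.f) p.1 ≤ (p.2 : EReal) ∧ p.2 + w ⬝ᵥ p.1 = m} =
      N.liftF {t | w ∈ N.optW t} := by
  ext ⟨t, z⟩
  constructor
  · rintro ⟨h1, h2⟩
    simp only at h1 h2
    have h3 := neg_f_le_iff.1 h1
    have h4 : N.f t = ((-z : ℝ) : EReal) := by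
      refine le_antisymm ?_ h3
      convert f_le_of_g_le (t := t) h.le using 2
      rw [dotProduct_comm]
      linarith
    refine ⟨mem_optW_iff.2 ⟨-z, h4, ?_⟩, h4⟩
    rw [h, EReal.coe_eq_coe_iff, dotProduct_comm]
    linarith
  · rintro ⟨h1, h2⟩
    simp only at h2
    obtain ⟨m', hf, hg⟩ := mem_optW_iff.1 h1
    have e₁ := EReal.coe_injective (h2.symm.trans hf)
    have e₂ := EReal.coe_injective (h.symm.trans hg)
    refine ⟨neg_f_le_iff.2 h2.ge, ?_⟩
    simp only at e₂ ⊢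
    rw [dotProduct_comm]
    linarith

theorem isNonverticalFace_epi_neg_f_iff [Finite V] {F : Set (N.Vec × ℝ)} :
    IsNonverticalFace (epi (-N.f)) F ↔
      ∃ w, {t | w ∈ N.optW t}.Nonempty ∧ F = N.liftF {t | w ∈ N.optW t} := by
  rw [isNonverticalFace_epi_iff]
  constructor
  · rintro ⟨⟨p, hp⟩, w, m, hm, rfl⟩
    have hg : N.g w = ((-m : ℝ) : EReal) := by
      refine le_antisymm (forall_neg_f_le_iff.1 hm) ?_
      convert le_g (w := w) (neg_f_le_iff.1 hp.1) using 2
      rw [dotProduct_comm, ← hp.2]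
      ring
    rw [setOf_neg_f_le_and_eq hg] at hp
    exact ⟨w, ⟨p.1, hp.1⟩, setOf_neg_f_le_and_eq hg⟩
  · rintro ⟨w, ⟨t, ht⟩, rfl⟩
    obtain ⟨m, hf, hg⟩ := mem_optW_iff.1 ht
    rw [← neg_neg (m - t ⬝ᵥ w)] at hg
    exact ⟨⟨(t, -m), ht, by rwa [neg_neg]⟩, w, _, forall_neg_f_le_iff.2 hg.le,
      (setOf_neg_f_le_and_eq hg).symm⟩

theorem setOf_g_le_and_eq [Finite V] (h : N.f t = (m : EReal)) :
    {p : N.Vec × ℝ | N.g p.1 ≤ (p.2 : EReal) ∧ p.2 + t ⬝ᵥ p.1 = m} = N.liftG (N.optW t) := by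
  ext ⟨w, z⟩
  constructor
  · rintro ⟨h1, h2⟩
    simp only at h1 h2
    obtain rfl : m - t ⬝ᵥ w = z := by linarith
    have h3 := le_antisymm h1 (le_g h.ge)
    exact ⟨mem_optW_iff.2 ⟨m, h, h3⟩, h3⟩
  · rintro ⟨h1, h2⟩
    simp only at h2
    obtain ⟨m', hf, hg⟩ := mem_optW_iff.1 h1
    have e₁ := EReal.coe_injective (h.symm.trans hf)
    have e₂ := EReal.coe_injective (h2.symm.trans hg)
    refine ⟨h2.le, ?_⟩
    simp only at e₂ ⊢
    linarith

theorem isNonverticalFace_epi_g_iff [Finite V] {G : Set (N.Vec × ℝ)} :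
    IsNonverticalFace (epi N.g) G ↔ ∃ t, (N.optW t).Nonempty ∧ G = N.liftG (N.optW t) := by
  classical
  rw [isNonverticalFace_epi_iff]
  constructor
  · rintro ⟨⟨p, hp⟩, t, m, hm, rfl⟩
    -- Since `g` is antitone, its epigraph is closed under increasing `w`, so a functional bounded
    -- below on it has nonnegative slope.
    have ht : 0 ≤ t := fun a => by
      have := hm (p.1 + Pi.single a 1) p.2
        ((g_antitone (le_add_of_nonneg_right (Pi.single_nonneg.2 zero_le_one))).trans hp.1)
      rw [dotProduct_add, dotProduct_single_one, ← hp.2] at this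
      rw [Pi.zero_apply]
      linarith
    have hf : N.f t = (m : EReal) := by
      refine le_antisymm ?_ (le_f ht fun w x hx => hm w _ (g_le_cost hx))
      rw [← hp.2]
      exact f_le_of_g_le hp.1
    rw [setOf_g_le_and_eq hf] at hp
    exact ⟨t, ⟨p.1, hp.1⟩, setOf_g_le_and_eq hf⟩
  · rintro ⟨t, ⟨w, hw⟩, rfl⟩
    obtain ⟨m, hf, hg⟩ := mem_optW_iff.1 hw
    refine ⟨⟨(w, m - t ⬝ᵥ w), hw, hg⟩, t, m, fun w' z hz => ?_, (setOf_g_le_and_eq hf).symm⟩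
    have := f_le_of_g_le (t := t) hz
    rwa [hf, EReal.coe_le_coe_iff] at this

theorem fst_image_liftF (w : N.Vec) :
    Prod.fst '' N.liftF {t | w ∈ N.optW t} = {t | w ∈ N.optW t} := by
  ext t
  constructor
  · rintro ⟨p, hp, rfl⟩
    exact hp.1
  · intro ht
    obtain ⟨m, hf, -⟩ := f_eq_of_mem_optW ht
    exact ⟨(t, -m), ⟨ht, by rwa [neg_neg]⟩, rfl⟩

theorem fst_image_liftG (t : N.Vec) : Prod.fst '' N.liftG (N.optW t) = N.optW t := by
  ext w
  constructor
  · rintro ⟨p, hp, rfl⟩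
    exact hp.1
  · intro hw
    obtain ⟨m, -, hg⟩ := f_eq_of_mem_optW hw
    exact ⟨(w, _), ⟨hw, hg⟩, rfl⟩

theorem affDim_liftF (h : {t | w ∈ N.optW t}.Nonempty) :
    affDim (N.liftF {t | w ∈ N.optW t}) = affDim {t | w ∈ N.optW t} := by
  classical
  obtain ⟨t₀, h₀⟩ := h
  obtain ⟨m₀, -, hg₀⟩ := f_eq_of_mem_optW h₀
  -- Here `-f t = -g w - t ⬝ᵥ w` on the base set, so the lift is the graph of an affine function.
  rw [← affDim_setOf_mem_and_eq {t | w ∈ N.optW t} (dotProductEquiv ℝ _ (-w))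
    (-(m₀ - t₀ ⬝ᵥ w))]
  congr 1
  ext ⟨t, z⟩
  refine and_congr_right fun ht => ?_
  obtain ⟨m, hf, hg⟩ := f_eq_of_mem_optW ht
  have e := EReal.coe_injective (hg₀.symm.trans hg)
  simp only at hf e
  simp only [hf, EReal.coe_eq_coe_iff, dotProductEquiv_apply_apply, neg_dotProduct, e,
    dotProduct_comm w]
  constructor <;> intro <;> linarith

theorem affDim_liftG (h : (N.optW t).Nonempty) :
    affDim (N.liftG (N.optW t)) = affDim (N.optW t) := by
  classical
  obtain ⟨w₀, h₀⟩ := h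
  obtain ⟨m₀, hf₀, -⟩ := f_eq_of_mem_optW h₀
  rw [← affDim_setOf_mem_and_eq (N.optW t) (dotProductEquiv ℝ _ (-t)) m₀]
  congr 1
  ext ⟨w, z⟩
  refine and_congr_right fun hw => ?_
  obtain ⟨m, hf, hg⟩ := f_eq_of_mem_optW hw
  have e := EReal.coe_injective (hf₀.symm.trans hf)
  simp only at hg
  simp only [hg, EReal.coe_eq_coe_iff, dotProductEquiv_apply_apply, neg_dotProduct, e]
  constructor <;> intro <;> linarith

theorem isActionSet_iff [Finite V] {T : Set N.Vec} : N.IsActionSet T ↔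
    ∃ w, {t | w ∈ N.optW t}.Nonempty ∧ T = {t | w ∈ N.optW t} := by
  constructor
  · rintro ⟨F, hF, rfl⟩
    obtain ⟨w, hne, rfl⟩ := isNonverticalFace_epi_neg_f_iff.1 hF
    exact ⟨w, hne, fst_image_liftF w⟩
  · rintro ⟨w, hne, rfl⟩
    exact ⟨_, isNonverticalFace_epi_neg_f_iff.2 ⟨w, hne, rfl⟩, (fst_image_liftF w).symm⟩

theorem isReactionSet_iff [Finite V] {W : Set N.Vec} : N.IsReactionSet W ↔
    ∃ t, (N.optW t).Nonempty ∧ W = N.optW t := by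
  constructor
  · rintro ⟨G, hG, rfl⟩
    obtain ⟨t, hne, rfl⟩ := isNonverticalFace_epi_g_iff.1 hG
    exact ⟨t, hne, fst_image_liftG t⟩
  · rintro ⟨t, hne, rfl⟩
    exact ⟨_, isNonverticalFace_epi_g_iff.2 ⟨t, hne, rfl⟩, (fst_image_liftG t).symm⟩

/-! ### The duality map -/

theorem exists_setW_eq_optW [Finite V] (h : {t | w ∈ N.optW t}.Nonempty) :
    ∃ t, w ∈ N.optW t ∧ N.setW {t | w ∈ N.optW t} = N.optW t ∧
      affDim {t | w ∈ N.optW t} + affDim (N.optW t) = N.tolled.card := by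
  obtain ⟨t, ht⟩ := h.intrinsicInterior (convex_setOf_mem_optW w)
  exact ⟨t, intrinsicInterior_subset (s := {t | w ∈ N.optW t}) ht, setW_setOf_mem_optW ht, affDim_add_affDim_optW ht⟩

/-- This gives surjectivity: `w` is chosen relatively interior to the reaction set. -/
theorem exists_optW_eq_setW [Finite V] (h : (N.optW t).Nonempty) :
    ∃ w, w ∈ N.optW t ∧ N.setW {t | w ∈ N.optW t} = N.optW t := by
  obtain ⟨w, hw⟩ := h.intrinsicInterior (convex_optW t)
  have hwt : w ∈ N.optW t := intrinsicInterior_subset hw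
  refine ⟨w, hwt, Set.Subset.antisymm (fun w' hw' => Set.mem_iInter₂.1 hw' t hwt)
    fun w' hw' => ?_⟩
  exact Set.mem_iInter₂.2 fun t' ht' => mem_optW_of_mem_intrinsicInterior' hw hw' ht'

/-- This gives injectivity: `w` itself lies in `setW` of its action set, so the action set can be
read off from that image. -/
theorem setOf_mem_optW_eq (w : N.Vec) :
    {t | w ∈ N.optW t} = {t | N.setW {t | w ∈ N.optW t} ⊆ N.optW t} :=
  Set.Subset.antisymm (fun t ht => Set.iInter₂_subset t ht)
    fun _ ht => ht (Set.mem_iInter₂.2 fun _ h => h)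

theorem setOf_mem_optW_eq_of_setW_eq {w' : N.Vec}
    (h : N.setW {t | w ∈ N.optW t} = N.setW {t | w' ∈ N.optW t}) :
    {t | w ∈ N.optW t} = {t | w' ∈ N.optW t} := by
  rw [setOf_mem_optW_eq w, setOf_mem_optW_eq w', h]

end NPP

theorem mainTheorem4 {V A K : Type*} [Fintype V] [DecidableEq V] [Fintype A] [Fintype K]
    (N : NPP V A K) :
    (∀ T : Set N.Vec, N.IsActionSet T →
      N.IsReactionSet (N.setW T) ∧ affDim T + affDim (N.setW T) = N.tolled.card) ∧
    Set.BijOn N.setW {T | N.IsActionSet T} {W | N.IsReactionSet W} ∧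
    Set.BijOn (fun F : Set (N.Vec × ℝ) => N.liftG (N.setW (Prod.fst '' F)))
      {F | IsNonverticalFace (epi (-N.f)) F} {G | IsNonverticalFace (epi N.g) G} ∧
    ∀ F : Set (N.Vec × ℝ), IsNonverticalFace (epi (-N.f)) F →
      affDim F + affDim (N.liftG (N.setW (Prod.fst '' F))) = N.tolled.card := by
  have h₁ : ∀ T : Set N.Vec, N.IsActionSet T →
      N.IsReactionSet (N.setW T) ∧ affDim T + affDim (N.setW T) = N.tolled.card := by
    intro T hT
    obtain ⟨w, hne, rfl⟩ := NPP.isActionSet_iff.1 hT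
    obtain ⟨t, hw, hset, hdim⟩ := NPP.exists_setW_eq_optW hne
    rw [hset]
    exact ⟨NPP.isReactionSet_iff.2 ⟨t, ⟨w, hw⟩, rfl⟩, hdim⟩
  refine ⟨h₁, ⟨fun T hT => (h₁ T hT).1, ?_, ?_⟩, ⟨?_, ?_, ?_⟩, ?_⟩
  · intro T hT T' hT' h
    obtain ⟨w, -, rfl⟩ := NPP.isActionSet_iff.1 hT
    obtain ⟨w', -, rfl⟩ := NPP.isActionSet_iff.1 hT'
    exact NPP.setOf_mem_optW_eq_of_setW_eq h
  · intro W hW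
    obtain ⟨t, hne, rfl⟩ := NPP.isReactionSet_iff.1 hW
    obtain ⟨w, hw, h⟩ := NPP.exists_optW_eq_setW hne
    exact ⟨_, NPP.isActionSet_iff.2 ⟨w, ⟨t, hw⟩, rfl⟩, h⟩
  · intro F hF
    obtain ⟨w, hne, rfl⟩ := NPP.isNonverticalFace_epi_neg_f_iff.1 hF
    obtain ⟨t, hw, hset, -⟩ := NPP.exists_setW_eq_optW hne
    exact NPP.isNonverticalFace_epi_g_iff.2
      ⟨t, ⟨w, hw⟩, by simp only [NPP.fst_image_liftF, hset]⟩
  · intro F hF F' hF' h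
    obtain ⟨w, hne, rfl⟩ := NPP.isNonverticalFace_epi_neg_f_iff.1 hF
    obtain ⟨w', hne', rfl⟩ := NPP.isNonverticalFace_epi_neg_f_iff.1 hF'
    simp only [NPP.fst_image_liftF] at h
    obtain ⟨t, -, hset, -⟩ := NPP.exists_setW_eq_optW hne
    obtain ⟨t', -, hset', -⟩ := NPP.exists_setW_eq_optW hne'
    have h' := congrArg (Prod.fst '' ·) h
    simp only [hset, hset', NPP.fst_image_liftG] at h'
    rw [← hset, ← hset'] at h'
    rw [NPP.setOf_mem_optW_eq_of_setW_eq h']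
  · intro G hG
    obtain ⟨t, hne, rfl⟩ := NPP.isNonverticalFace_epi_g_iff.1 hG
    obtain ⟨w, hw, h⟩ := NPP.exists_optW_eq_setW hne
    exact ⟨_, NPP.isNonverticalFace_epi_neg_f_iff.2 ⟨w, ⟨t, hw⟩, rfl⟩,
      by simp only [NPP.fst_image_liftF, h]⟩
  · intro F hF
    obtain ⟨w, hne, rfl⟩ := NPP.isNonverticalFace_epi_neg_f_iff.1 hF
    obtain ⟨t, hw, hset, hdim⟩ := NPP.exists_setW_eq_optW hne
    rw [NPP.fst_image_liftF, hset, NPP.affDim_liftF hne, NPP.affDim_liftG ⟨w, hw⟩, hdim]
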